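/- Let $P \subseteq \mathbb{R}^2$ be a two-dimensional rational convex polytope, that is, the convex hull of finitely many points of $\mathbb{Q}^2$ whose affine hull is $\mathbb{R}^2$. For $n \in \mathbb{N} = \{0,1,2,\dots\}$ let $L_P(n) = \#(nP \cap \mathbb{Z}^2)$, where $nP=\{nx : x\in P\}$. Suppose that $P$ is a quasi-lattice polytope, i.e. its Ehrhart quasi-polynomial is a polynomial: there is a polynomial $q \in \mathbb{R}[x]$ with $q(n) = L_P(n)$ for all $n \in \mathbb{N}$. For $S \subseteq \mathbb{R}^2$ let $S^* = \{x \in \mathbb{R}^2 : \langle x, s\rangle \le 1 \text{ for all } s \in S\}$ be its polar dual. A convex polytope $P\subseteq\mathbb{R}^2$ is called dual-integral if there is a lattice point $p \in \mathbb{Z}^2$ such that $(P-p)^*$ is a lattice polytope, i.e. the convex hull of finitely many points of $\mathbb{Z}^2$. Then $P$ is dual-integral if and only if the interior of $P$ contains exactly one point of $\mathbb{Z}^2$. -/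

import Mathlib

open scoped Pointwise

noncomputable section

namespace EhrhartPolytope

/-- The set of lattice points `ℤ^d` in `ℝ^d`. -/
def latticePoints (d : ℕ) : Set (EuclideanSpace ℝ (Fin d)) :=
  {x | ∀ i, ∃ m : ℤ, x i = (m : ℝ)}

/-- The set of rational points `ℚ^d` in `ℝ^d`. -/
def rationalPoints (d : ℕ) : Set (EuclideanSpace ℝ (Fin d)) :=
  {x | ∀ i, ∃ q : ℚ, x i = (q : ℝ)}

/-- A convex polytope: the convex hull of finitely many points. -/
def IsConvexPolytope {d : ℕ} (P : Set (EuclideanSpace ℝ (Fin d))) : Prop :=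
  ∃ V : Set (EuclideanSpace ℝ (Fin d)), V.Finite ∧ P = convexHull ℝ V

/-- A rational convex polytope: the convex hull of finitely many rational points. -/
def IsRationalPolytope {d : ℕ} (P : Set (EuclideanSpace ℝ (Fin d))) : Prop :=
  ∃ V : Set (EuclideanSpace ℝ (Fin d)), V.Finite ∧ V ⊆ rationalPoints d ∧ P = convexHull ℝ V

/-- A lattice polytope: the convex hull of finitely many lattice points. -/
def IsLatticePolytope {d : ℕ} (P : Set (EuclideanSpace ℝ (Fin d))) : Prop :=
  ∃ V : Set (EuclideanSpace ℝ (Fin d)), V.Finite ∧ V ⊆ latticePoints d ∧ P = convexHull ℝ V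

/-- The dimension of a set: the dimension of its affine hull. -/
def affineDim {d : ℕ} (P : Set (EuclideanSpace ℝ (Fin d))) : ℕ :=
  Module.finrank ℝ (vectorSpan ℝ P)

/-- The polar dual `S^* = {x | ⟨x, s⟩ ≤ 1 for all s ∈ S}`. -/
def polarDual {d : ℕ} (S : Set (EuclideanSpace ℝ (Fin d))) : Set (EuclideanSpace ℝ (Fin d)) :=
  {x | ∀ s ∈ S, inner ℝ x s ≤ 1}

/-- A convex polytope `P` is dual-integral if for some lattice point `p` the polar dual of
`P - p` is a lattice polytope. -/
def IsDualIntegral {d : ℕ} (P : Set (EuclideanSpace ℝ (Fin d))) : Prop :=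
  IsConvexPolytope P ∧
    ∃ p ∈ latticePoints d, IsLatticePolytope (polarDual ((fun x => x - p) '' P))

/-- The counting function `L_S(n) = #(nS ∩ ℤ^d)`. -/
def latticeCount {d : ℕ} (S : Set (EuclideanSpace ℝ (Fin d))) (n : ℕ) : ℕ :=
  (((n : ℝ) • S) ∩ latticePoints d).ncard

/-- A quasi-polynomial: a function `f(x) = a_k(x) x^k + ... + a_0(x)` whose coefficients are
periodic functions with (positive) integral periods, and with `a_k` not identically zero. -/
def IsQuasiPolynomial (f : ℝ → ℝ) : Prop :=
  ∃ (k : ℕ) (a : ℕ → ℝ → ℝ),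
    (∀ i, ∃ T : ℕ, 0 < T ∧ Function.Periodic (a i) (T : ℝ)) ∧
    (∃ x, a k x ≠ 0) ∧
    ∀ x, f x = ∑ i ∈ Finset.range (k + 1), a i x * x ^ i

/-- `f` is an Ehrhart quasi-polynomial of `P`: a quasi-polynomial that agrees with the
lattice point count of the dilates `nP` for every natural number `n`. -/
def IsEhrhartQuasiPolynomial {d : ℕ} (P : Set (EuclideanSpace ℝ (Fin d))) (f : ℝ → ℝ) : Prop :=
  IsQuasiPolynomial f ∧ ∀ n : ℕ, f (n : ℝ) = (latticeCount P n : ℝ)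

/-- A quasi-lattice polytope: a rational convex polytope whose Ehrhart quasi-polynomial
is a polynomial. -/
def IsQuasiLattice {d : ℕ} (P : Set (EuclideanSpace ℝ (Fin d))) : Prop :=
  IsRationalPolytope P ∧
    ∃ q : Polynomial ℝ, IsEhrhartQuasiPolynomial P (fun x => q.eval x)

end EhrhartPolytope

end

namespace EhrhartPolytope

/-! Write `Q = P - p` for a lattice point `p`.

If the polar of `Q` is a lattice polytope, it is bounded, so the origin is interior to `Q`. An
interior lattice point `x` of `Q` satisfies `⟨u, x⟩ < 1` for every generator `u` of the polar. These
values are integers, hence `≤ 0`, and boundedness of `Q` forces `x = 0`.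

Conversely, let `p` be the only interior lattice point. The polar of `Q` is the hull of its finitely
many extreme points `u`, which are rational; let `D` be a common denominator. The function `h x =
max_u D⟨u, x⟩` is integral on `ℤ²`, and `nQ` and its interior are given by `h ≤ nD` and `h < nD`.
Ehrhart reciprocity (`exists_quasiQuadratic_reciprocity`) provides a quasi-quadratic `F` with `F t =
#{h ≤ t}` and `F (-t) = #{h < t}`. By hypothesis `F (nD)` is a polynomial `a n² + b n + c`. Since `F
0 = 1 = F (-D)`, one gets `a = b`, so the polynomial is invariant under `n ↦ -1 - n`. Thus `#{h <
(n+1)D} = #{h ≤ nD}`: no value of `h` lies strictly between consecutive multiples of `D`, and `D ∣ h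
x` always (`dvd_of_polynomial_count`).

On the cone where `u` attains the maximum, `⟨u, ·⟩ = h / D` is therefore integral. This cone
contains some `z`, `z + e₁`, `z + e₂`, and differences show that `u` is integral. -/

/-! ### Finite cardinalities and triangular numbers -/

/-- The set `S` is finite with `c` elements. -/
def HasCard {α : Type*} (S : Set α) (c : ℚ) : Prop := S.Finite ∧ (S.ncard : ℚ) = c

theorem HasCard.union {α : Type*} {S T : Set α} {c d : ℚ} (hS : HasCard S c) (hT : HasCard T d)
    (h : Disjoint S T) : HasCard (S ∪ T) (c + d) := by
  refine ⟨hS.1.union hT.1, ?_⟩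
  rw [Set.ncard_union_eq h hS.1 hT.1, Nat.cast_add, hS.2, hT.2]

theorem hasCard_coe_finset {α : Type*} (s : Finset α) : HasCard (s : Set α) s.card :=
  ⟨s.finite_toSet, by rw [Set.ncard_coe_finset]⟩

/-- The polynomial counting pairs of natural numbers with sum at most `m`. -/
def triangular (m : ℤ) : ℚ := ((m : ℚ) + 1) * (m + 2) / 2

theorem exists_finset_pairs_le (K : ℤ) (hK : -2 ≤ K) :
    ∃ s : Finset (ℕ × ℕ), (∀ y, y ∈ s ↔ (y.1 : ℤ) + y.2 ≤ K) ∧ (s.card : ℚ) = triangular K := by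
  rcases lt_or_ge K 0 with h | h
  · refine ⟨∅, fun y => ?_, ?_⟩
    · simp; omega
    -- Both values are roots of `triangular`, so the formula also holds for these empty sets.
    · have : K = -2 ∨ K = -1 := by omega
      rcases this with rfl | rfl <;> simp [triangular]
  · lift K to ℕ using h
    refine ⟨(Finset.range (K + 1)).biUnion Finset.HasAntidiagonal.antidiagonal, fun y => ?_, ?_⟩
    · simp; omega
    · rw [Finset.card_biUnion]
      · simp only [Finset.Nat.card_antidiagonal]
        clear hK
        induction K with
        | zero => simp [triangular]
        | succ n ih =>
          rw [Finset.sum_range_succ, Nat.cast_add, ih]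
          simp only [triangular]; push_cast; ring
      · intro i _ j _ hij
        rw [Function.onFun, Finset.disjoint_left]
        intro a ha hb
        rw [Finset.HasAntidiagonal.mem_antidiagonal] at ha hb
        exact hij (ha.symm.trans hb)

/-! ### Lattice points of half-open planar cones -/

/-- The determinant of two integer vectors. -/
def det (x y : ℤ × ℤ) : ℤ := x.1 * y.2 - x.2 * y.1

/-- The value of the linear functional `u` at `x`. -/
def pairing (u x : ℤ × ℤ) : ℤ := u.1 * x.1 + u.2 * x.2

/-- The lattice points `x` with `ε ≤ det x w` and `δ ≤ det v x`; for `ε, δ ∈ {0, 1}` these are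
the lattice points of the cone spanned by `v` and `w`, with or without its boundary rays. -/
def cone (ε δ : ℤ) (v w : ℤ × ℤ) : Set (ℤ × ℤ) := {x | ε ≤ det x w ∧ δ ≤ det v x}

/-- The lattice points of a half-open fundamental parallelogram of the cone. -/
def tile (ε δ : ℤ) (v w : ℤ × ℤ) : Set (ℤ × ℤ) :=
  {x | (ε ≤ det x w ∧ det x w < det v w + ε) ∧ δ ≤ det v x ∧ det v x < det v w + δ}

theorem ext_of_det {v w x y : ℤ × ℤ} (hvw : 0 < det v w) (h1 : det x w = det y w)
    (h2 : det v x = det v y) : x = y := by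
  simp only [det] at *
  ext
  · have : (v.1 * w.2 - v.2 * w.1) * (x.1 - y.1) = 0 := by linear_combination v.1 * h1 + w.1 * h2
    rcases mul_eq_zero.1 this with h | h <;> omega
  · have : (v.1 * w.2 - v.2 * w.1) * (x.2 - y.2) = 0 := by linear_combination v.2 * h1 + w.2 * h2
    rcases mul_eq_zero.1 this with h | h <;> omega

theorem tile_finite (ε δ : ℤ) {v w : ℤ × ℤ} (hvw : 0 < det v w) : (tile ε δ v w).Finite := by
  refine Set.Finite.of_injOn (f := fun x => (det x w, det v x))
    (t := Set.Icc ε (det v w + ε) ×ˢ Set.Icc δ (det v w + δ)) ?_ ?_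
    ((Set.finite_Icc _ _).prod (Set.finite_Icc _ _))
  · rintro x ⟨⟨h1, h2⟩, h3, h4⟩
    exact ⟨⟨h1, h2.le⟩, h3, h4.le⟩
  · intro x _ y _ hxy
    simp only [Prod.mk.injEq] at hxy
    exact ext_of_det hvw hxy.1 hxy.2

theorem det_tile_add_left (v w p : ℤ × ℤ) (k l : ℕ) :
    det (p + (k : ℤ) • v + (l : ℤ) • w) w = det p w + det v w * k := by
  simp [det]; ring

theorem det_tile_add_right (v w p : ℤ × ℤ) (k l : ℕ) :
    det v (p + (k : ℤ) • v + (l : ℤ) • w) = det v p + det v w * l := by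
  simp [det]; ring

/-- Every cone point is uniquely `p + k v + l w` with `p` in the tile. For fixed `p` the condition
`h ≤ t` becomes `k + l ≤ (t - h p) / E`, and `hb` keeps this quotient at least `-2`, where
`triangular` still counts correctly. -/
theorem hasCard_cone_le (ε δ : ℤ) {v w : ℤ × ℤ} (hvw : 0 < det v w) (h : ℤ × ℤ → ℤ) (E t : ℤ)
    (hE : 0 < E)
    (hh : ∀ p ∈ tile ε δ v w, ∀ k l : ℕ, h (p + (k : ℤ) • v + (l : ℤ) • w) = h p + E * (k + l))
    (hb : ∀ p ∈ tile ε δ v w, h p ≤ t + 2 * E) :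
    HasCard {x | x ∈ cone ε δ v w ∧ h x ≤ t}
      (∑ p ∈ (tile_finite ε δ hvw).toFinset, triangular ((t - h p) / E)) := by
  classical
  have key : ∀ p : ℤ × ℤ, ∃ s : Finset (ℕ × ℕ), p ∈ tile ε δ v w →
      (∀ y, y ∈ s ↔ (y.1 : ℤ) + y.2 ≤ (t - h p) / E) ∧ (s.card : ℚ) = triangular ((t - h p) / E) := by
    intro p
    by_cases hp : p ∈ tile ε δ v w
    · have : -2 ≤ (t - h p) / E := by
        rw [Int.le_ediv_iff_mul_le hE]; linarith [hb p hp]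
      obtain ⟨s, hs⟩ := exists_finset_pairs_le _ this
      exact ⟨s, fun _ => hs⟩
    · exact ⟨∅, fun h => absurd h hp⟩
  choose s hs using key
  let f : (Σ _ : ℤ × ℤ, ℕ × ℕ) → ℤ × ℤ := fun y => y.1 + (y.2.1 : ℤ) • v + (y.2.2 : ℤ) • w
  have hset : {x | x ∈ cone ε δ v w ∧ h x ≤ t} =
      (((tile_finite ε δ hvw).toFinset.sigma s).image f : Finset (ℤ × ℤ)) := by
    ext x
    simp only [Set.mem_ofPred_eq, Finset.coe_image, Set.mem_image, Finset.mem_coe,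
      Finset.mem_sigma, Set.Finite.mem_toFinset]
    constructor
    · rintro ⟨⟨h1, h2⟩, h3⟩
      have hk : 0 ≤ (det x w - ε) / det v w := Int.ediv_nonneg (by linarith) hvw.le
      have hl : 0 ≤ (det v x - δ) / det v w := Int.ediv_nonneg (by linarith) hvw.le
      obtain ⟨k, hk'⟩ := Int.eq_ofNat_of_zero_le hk
      obtain ⟨l, hl'⟩ := Int.eq_ofNat_of_zero_le hl
      have e1 := Int.emod_add_mul_ediv (det x w - ε) (det v w)
      have e2 := Int.emod_add_mul_ediv (det v x - δ) (det v w)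
      have b1 := Int.emod_nonneg (det x w - ε) hvw.ne'
      have b2 := Int.emod_nonneg (det v x - δ) hvw.ne'
      have b3 := Int.emod_lt_of_pos (det x w - ε) hvw
      have b4 := Int.emod_lt_of_pos (det v x - δ) hvw
      rw [hk'] at e1
      rw [hl'] at e2
      let p := x - (k : ℤ) • v - (l : ℤ) • w
      have hx : p + (k : ℤ) • v + (l : ℤ) • w = x := by simp only [p]; abel
      have d1 := det_tile_add_left v w p k l
      have d2 := det_tile_add_right v w p k l
      rw [hx] at d1 d2
      have hp : p ∈ tile ε δ v w :=
        ⟨⟨by linarith, by linarith⟩, by linarith, by linarith⟩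
      refine ⟨⟨p, k, l⟩, ⟨hp, ?_⟩, hx⟩
      rw [((hs p) hp).1, Int.le_ediv_iff_mul_le hE]
      have := hh p hp k l
      rw [hx] at this
      linarith
    · rintro ⟨⟨p, k, l⟩, ⟨hp, hkl⟩, rfl⟩
      dsimp only at hp hkl
      rw [((hs p) hp).1, Int.le_ediv_iff_mul_le hE] at hkl
      have hk : 0 ≤ det v w * (k : ℤ) := by positivity
      have hl : 0 ≤ det v w * (l : ℤ) := by positivity
      refine ⟨⟨?_, ?_⟩, ?_⟩
      · simp only [f, det_tile_add_left]; linarith [hp.1.1]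
      · simp only [f, det_tile_add_right]; linarith [hp.2.1]
      · simp only [f, hh p hp]; linarith
  have hinj : Set.InjOn f ((tile_finite ε δ hvw).toFinset.sigma s) := by
    rintro ⟨p, k, l⟩ hp ⟨p', k', l'⟩ hp' he
    simp only [Finset.coe_sigma, Set.mem_sigma_iff, Finset.mem_coe, Set.Finite.mem_toFinset] at hp hp'
    simp only [f] at he
    have a1 := det_tile_add_left v w p k l
    have a2 := det_tile_add_right v w p k l
    rw [he, det_tile_add_left] at a1
    rw [he, det_tile_add_right] at a2
    obtain ⟨⟨⟨p1, p2⟩, p3, p4⟩, -⟩ := hp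
    obtain ⟨⟨⟨q1, q2⟩, q3, q4⟩, -⟩ := hp'
    have aux : ∀ a b c d e : ℤ, 0 < c → a + c * d = b + c * e → a < b + c → b < a + c → d = e := by
      intro a b c d e hc h h1 h2
      have i1 : c * (d - e) < c * 1 := by linarith
      have i2 : c * (-1) < c * (d - e) := by linarith
      have := lt_of_mul_lt_mul_left i1 hc.le
      have := lt_of_mul_lt_mul_left i2 hc.le
      omega
    have hk : (k' : ℤ) = k := aux _ _ _ _ _ hvw a1 (by linarith) (by linarith)
    have hl : (l' : ℤ) = l := aux _ _ _ _ _ hvw a2 (by linarith) (by linarith)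
    have hk' : k' = k := by exact_mod_cast hk
    have hl' : l' = l := by exact_mod_cast hl
    subst hk' hl'
    have : p = p' := by simpa using he
    subst this
    rfl
  rw [hset]
  have := hasCard_coe_finset (((tile_finite ε δ hvw).toFinset.sigma s).image f)
  rw [Finset.card_image_of_injOn hinj, Finset.card_sigma, Nat.cast_sum] at this
  convert this using 1
  refine Finset.sum_congr rfl fun p hp => ?_
  exact ((hs p) (by simpa using hp)).2.symm

/-! ### Quasi-quadratic functions -/

/-- A quadratic quasi-polynomial on the integers. -/
def IsQuasiQuadratic (F : ℤ → ℚ) : Prop :=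
  ∃ M : ℤ, 0 < M ∧ ∀ r : ℤ, ∃ a b c : ℚ, ∀ m : ℤ, F (r + M * m) = a * m ^ 2 + b * m + c

theorem IsQuasiQuadratic.const (c : ℚ) : IsQuasiQuadratic fun _ => c :=
  ⟨1, one_pos, fun _ => ⟨0, 0, c, fun _ => by simp⟩⟩

theorem IsQuasiQuadratic.add {F G : ℤ → ℚ} (hF : IsQuasiQuadratic F) (hG : IsQuasiQuadratic G) :
    IsQuasiQuadratic fun t => F t + G t := by
  obtain ⟨M, hM, hF⟩ := hF
  obtain ⟨N, hN, hG⟩ := hG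
  refine ⟨M * N, mul_pos hM hN, fun r => ?_⟩
  obtain ⟨a, b, c, h⟩ := hF r
  obtain ⟨a', b', c', h'⟩ := hG r
  refine ⟨a * N ^ 2 + a' * M ^ 2, b * N + b' * M, c + c', fun m => ?_⟩
  have e1 := h (N * m)
  have e2 := h' (M * m)
  dsimp only
  rw [show r + M * N * m = r + M * (N * m) by ring, e1,
    show r + M * (N * m) = r + N * (M * m) by ring, e2]
  push_cast; ring

theorem IsQuasiQuadratic.sum {ι : Type*} (s : Finset ι) (F : ι → ℤ → ℚ)
    (h : ∀ i ∈ s, IsQuasiQuadratic (F i)) : IsQuasiQuadratic fun t => ∑ i ∈ s, F i t := by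
  classical
  induction s using Finset.induction_on with
  | empty => simpa using IsQuasiQuadratic.const 0
  | insert i s hi ih =>
    simp only [Finset.sum_insert hi]
    exact (h i (by simp)).add (ih fun j hj => h j (by simp [hj]))

theorem isQuasiQuadratic_triangular_ediv (E c : ℤ) (hE : 0 < E) :
    IsQuasiQuadratic fun t => triangular ((t - c) / E) := by
  refine ⟨E, hE, fun r => ?_⟩
  refine ⟨1 / 2, (2 * ((r - c) / E : ℤ) + 3) / 2, triangular ((r - c) / E), fun m => ?_⟩
  dsimp only
  rw [show r + E * m - c = r - c + E * m by ring, Int.add_mul_ediv_left _ _ hE.ne']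
  simp only [triangular]; push_cast; ring

/-! ### Ehrhart reciprocity in the plane -/

/-- Reciprocity for the sublevel sets of `h` on the cone spanned by `v` and `w`. -/
def Reciprocal (h : ℤ × ℤ → ℤ) (v w : ℤ × ℤ) : Prop :=
  ∃ F : ℤ → ℚ, IsQuasiQuadratic F ∧ ∀ t : ℤ, 0 ≤ t →
    HasCard {x | x ∈ cone 0 1 v w ∧ h x ≤ t} (F t) ∧
    HasCard {x | x ∈ cone 1 0 v w ∧ h x < t} (F (-t))

theorem pairing_mul_det (u v w x : ℤ × ℤ) :
    det v w * pairing u x = det x w * pairing u v + det v x * pairing u w := by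
  simp only [det, pairing]; ring

theorem mem_tile_reflect (v w p : ℤ × ℤ) : v + w - p ∈ tile 1 0 v w ↔ p ∈ tile 0 1 v w := by
  have h1 : det (v + w - p) w = det v w - det p w := by simp [det]; ring
  have h2 : det v (v + w - p) = det v w - det v p := by simp [det]; ring
  simp only [tile, Set.mem_ofPred_eq, h1, h2]
  constructor <;> rintro ⟨⟨a, b⟩, c, d⟩ <;> refine ⟨⟨?_, ?_⟩, ?_, ?_⟩ <;> omega

/-- The two floor quotients add up to `-3`, and `triangular` is symmetric under `m ↦ -3 - m`. -/
theorem triangular_reflect (E c t : ℤ) (hE : 0 < E) :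
    triangular ((t - 1 - (2 * E - c)) / E) = triangular ((-t - c) / E) := by
  have e1 : (t - 1 - (2 * E - c)) / E = (t + c - 1) / E - 2 := by
    rw [show t - 1 - (2 * E - c) = (t + c - 1) + E * (-2) by ring,
      Int.add_mul_ediv_left _ _ hE.ne']; ring
  have e2 : (-t - c) / E = -1 - (t + c - 1) / E := by
    have a := Int.emod_add_mul_ediv (t + c - 1) E
    have b1 := Int.emod_nonneg (t + c - 1) hE.ne'
    have b2 := Int.emod_lt_of_pos (t + c - 1) hE
    rw [show -t - c = (E - 1 - (t + c - 1) % E) + E * (-1 - (t + c - 1) / E) by linarith,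
      Int.add_mul_ediv_left _ _ hE.ne', Int.ediv_eq_zero_of_lt (by linarith) (by linarith)]
    ring
  rw [e1, e2]
  simp only [triangular]; push_cast; ring

/-- The reflection `p ↦ v + w - p` exchanges the two half-open tiles and replaces `h p` by `2E - h
p`; `triangular_reflect` then matches the two counts term by term. -/
theorem reciprocal_of_linear_of_eq {h : ℤ × ℤ → ℤ} {v w u : ℤ × ℤ} (hvw : 0 < det v w)
    (hu : ∀ x, 0 ≤ det x w → 0 ≤ det v x → h x = pairing u x) {E : ℤ} (hE : 0 < E)
    (hv : h v = E) (hw : h w = E) : Reciprocal h v w := by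
  have uv : pairing u v = E := by rw [← hu v hvw.le (by simp [det, mul_comm]), hv]
  have uw : pairing u w = E := by rw [← hu w (by simp [det, mul_comm]) hvw.le, hw]
  have hadd : ∀ ε δ : ℤ, 0 ≤ ε → 0 ≤ δ → ∀ p ∈ tile ε δ v w, ∀ k l : ℕ,
      h (p + (k : ℤ) • v + (l : ℤ) • w) = h p + E * (k + l) := by
    rintro ε δ hε hδ p ⟨⟨h1, h2⟩, h3, h4⟩ k l
    have hk : 0 ≤ det v w * (k : ℤ) := by positivity
    have hl : 0 ≤ det v w * (l : ℤ) := by positivity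
    rw [hu _ (by rw [det_tile_add_left]; linarith) (by rw [det_tile_add_right]; linarith),
      hu p (by linarith) (by linarith)]
    have : pairing u (p + (k : ℤ) • v + (l : ℤ) • w) =
        pairing u p + k * pairing u v + l * pairing u w := by simp [pairing]; ring
    rw [this, uv, uw]; ring
  have hbd : ∀ ε δ : ℤ, 0 ≤ ε → 0 ≤ δ → ε + δ = 1 → ∀ p ∈ tile ε δ v w, h p < 2 * E := by
    rintro ε δ hε hδ hs p ⟨⟨h1, h2⟩, h3, h4⟩
    rw [hu p (by linarith) (by linarith)]
    have := pairing_mul_det u v w p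
    rw [uv, uw] at this
    -- As `ε + δ = 1`, at most one of the two determinants can reach `det v w`, whence strictness.
    have h5 : det p w + det v p < 2 * det v w := by omega
    have h6 : det v w * pairing u p < det v w * (2 * E) := by
      rw [this]; nlinarith
    exact lt_of_mul_lt_mul_left h6 hvw.le
  refine ⟨fun t => ∑ p ∈ (tile_finite 0 1 hvw).toFinset, triangular ((t - h p) / E),
    IsQuasiQuadratic.sum _ _ fun p _ => isQuasiQuadratic_triangular_ediv E _ hE, fun t ht => ⟨?_, ?_⟩⟩
  · refine hasCard_cone_le 0 1 hvw h E t hE (hadd 0 1 le_rfl zero_le_one) fun p hp => ?_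
    linarith [hbd 0 1 le_rfl zero_le_one rfl p hp]
  · have := hasCard_cone_le 1 0 hvw h E (t - 1) hE (hadd 1 0 zero_le_one le_rfl) fun p hp => by
      linarith [Int.add_one_le_iff.2 (hbd 1 0 zero_le_one le_rfl rfl p hp)]
    simp only [Int.le_sub_one_iff] at this
    convert this using 1
    refine Finset.sum_bij (fun p _ => v + w - p) ?_ ?_ ?_ ?_
    · intro p hp
      simpa [mem_tile_reflect] using hp
    · intro p _ q _ hpq
      simpa using hpq
    · intro p hp
      refine ⟨v + w - p, ?_, by simp⟩
      rw [Set.Finite.mem_toFinset] at hp ⊢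
      rw [← mem_tile_reflect]; simpa using hp
    · intro p hp
      rw [Set.Finite.mem_toFinset] at hp
      obtain ⟨⟨h1, -⟩, h3, -⟩ := id hp
      obtain ⟨⟨h1', -⟩, h3', -⟩ := (mem_tile_reflect v w p).2 hp
      rw [← triangular_reflect E _ t hE]
      congr 3
      rw [hu p h1 (by linarith), hu _ (by linarith) h3']
      have : pairing u (v + w - p) = pairing u v + pairing u w - pairing u p := by
        simp [pairing]; ring
      rw [this, uv, uw]; ring

theorem cone_smul (ε δ : ℤ) (hε : ε = 0 ∨ ε = 1) (hδ : δ = 0 ∨ δ = 1) (v w : ℤ × ℤ) {a b : ℤ}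
    (ha : 0 < a) (hb : 0 < b) : cone ε δ (a • v) (b • w) = cone ε δ v w := by
  ext x
  have h1 : det x (b • w) = b * det x w := by simp [det]; ring
  have h2 : det (a • v) x = a * det v x := by simp [det]; ring
  have aux : ∀ e c d : ℤ, e = 0 ∨ e = 1 → 0 < c → (e ≤ c * d ↔ e ≤ d) := by
    rintro e c d (rfl | rfl) hc
    · exact mul_nonneg_iff_of_pos_left hc
    · exact mul_pos_iff_of_pos_left hc
  simp only [cone, Set.mem_ofPred_eq, h1, h2, aux _ _ _ hε hb, aux _ _ _ hδ ha]

/-- The generators are rescaled to `h w • v` and `h v • w`, both at level `h v * h w`; the half-open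
cones do not change. -/
theorem reciprocal_of_linear {h : ℤ × ℤ → ℤ} {v w u : ℤ × ℤ} (hvw : 0 < det v w)
    (hu : ∀ x, 0 ≤ det x w → 0 ≤ det v x → h x = pairing u x) (hv : 0 < h v) (hw : 0 < h w) :
    Reciprocal h v w := by
  have uv := hu v hvw.le (by simp [det, mul_comm])
  have uw := hu w (by simp [det, mul_comm]) hvw.le
  have d1 : ∀ x, det x (h v • w) = h v * det x w := fun x => by simp [det]; ring
  have d2 : ∀ x, det (h w • v) x = h w * det v x := fun x => by simp [det]; ring
  have hu' : ∀ x, 0 ≤ det x (h v • w) → 0 ≤ det (h w • v) x → h x = pairing u x := by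
    intro x h1 h2
    rw [d1] at h1
    rw [d2] at h2
    exact hu x (nonneg_of_mul_nonneg_right h1 hv) (nonneg_of_mul_nonneg_right h2 hw)
  have hd : 0 < det (h w • v) (h v • w) := by rw [d1, d2]; positivity
  have := reciprocal_of_linear_of_eq hd hu' (mul_pos hv hw)
    (by rw [hu' _ hd.le (by simp [det, mul_comm]), uv]; simp [pairing]; ring)
    (by rw [hu' _ (by simp [det, mul_comm]) hd.le, uw]; simp [pairing]; ring)
  simpa only [Reciprocal, cone_smul 0 1 (.inl rfl) (.inr rfl) v w hw hv,
    cone_smul 1 0 (.inr rfl) (.inl rfl) v w hw hv] using this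

/-- The half-open convention puts the ray of `z` in exactly one of the two pieces, so no
inclusion-exclusion is needed when gluing. -/
theorem cone_split (ε δ : ℤ) (hεδ : ε = 0 ∧ δ = 1 ∨ ε = 1 ∧ δ = 0) {v w z : ℤ × ℤ}
    (hvw : 0 < det v w) (h1 : 0 < det v z) (h2 : 0 < det z w) :
    cone ε δ v w = cone ε δ v z ∪ cone ε δ z w ∧ Disjoint (cone ε δ v z) (cone ε δ z w) := by
  have anti : ∀ x, det x z = - det z x := fun x => by simp only [det]; ring
  have p1 : ∀ x, det v z * det x w = det v w * det x z + det v x * det z w := fun x => by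
    simp only [det]; ring
  constructor
  · ext x
    have p1 := p1 x
    have anti := anti x
    simp only [cone, Set.mem_ofPred_eq, Set.mem_union]
    constructor
    · rintro ⟨a, b⟩
      by_cases hc : ε ≤ det x z
      · exact .inl ⟨hc, b⟩
      · exact .inr ⟨a, by omega⟩
    · rintro (⟨a, b⟩ | ⟨a, b⟩)
      · refine ⟨?_, b⟩
        rcases hεδ with ⟨rfl, rfl⟩ | ⟨rfl, rfl⟩
        · refine nonneg_of_mul_nonneg_right (a := det v z) ?_ h1
          rw [p1]; have := mul_nonneg hvw.le a; nlinarith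
        · refine pos_of_mul_pos_right (a := det v z) ?_ h1.le
          rw [p1]; have := mul_pos hvw a; have := mul_nonneg b h2.le; linarith
      · refine ⟨a, ?_⟩
        have p2 : det v x * det z w = det v z * det x w + det v w * det z x := by
          rw [p1, anti]; ring
        rcases hεδ with ⟨rfl, rfl⟩ | ⟨rfl, rfl⟩
        · refine pos_of_mul_pos_left (b := det z w) ?_ h2.le
          rw [p2]; have := mul_pos hvw b; have := mul_nonneg h1.le a; linarith
        · refine nonneg_of_mul_nonneg_left (b := det z w) ?_ h2
          rw [p2]; have := mul_nonneg hvw.le b; have := mul_pos h1 a; linarith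
  · rw [Set.disjoint_left]
    rintro x ⟨a, -⟩ ⟨-, b⟩
    have := anti x
    omega

theorem Reciprocal.glue {h : ℤ × ℤ → ℤ} {v w z : ℤ × ℤ} (hvw : 0 < det v w) (h1 : 0 < det v z)
    (h2 : 0 < det z w) (r1 : Reciprocal h v z) (r2 : Reciprocal h z w) : Reciprocal h v w := by
  obtain ⟨F, hF, hF'⟩ := r1
  obtain ⟨G, hG, hG'⟩ := r2
  refine ⟨_, hF.add hG, fun t ht => ?_⟩
  obtain ⟨s1, d1⟩ := cone_split 0 1 (.inl ⟨rfl, rfl⟩) hvw h1 h2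
  obtain ⟨s2, d2⟩ := cone_split 1 0 (.inr ⟨rfl, rfl⟩) hvw h1 h2
  constructor
  · have := (hF' t ht).1.union (hG' t ht).1 (d1.mono (fun x hx => hx.1) fun x hx => hx.1)
    convert this using 1
    ext x
    simp only [s1, Set.mem_ofPred_eq, Set.mem_union]; tauto
  · have := (hF' t ht).2.union (hG' t ht).2 (d2.mono (fun x hx => hx.1) fun x hx => hx.1)
    convert this using 1
    ext x
    simp only [s2, Set.mem_ofPred_eq, Set.mem_union]; tauto

/-- Pairs of functionals whose difference changes sign from negative to positive between
`v` and `w`. -/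
def crossing (U : Finset (ℤ × ℤ)) (v w : ℤ × ℤ) : Finset ((ℤ × ℤ) × (ℤ × ℤ)) :=
  (U ×ˢ U).filter fun p => pairing p.1 v < pairing p.2 v ∧ pairing p.2 w < pairing p.1 w

theorem reciprocal_max (U : Finset (ℤ × ℤ)) (h : ℤ × ℤ → ℤ)
    (hle : ∀ x, ∀ u ∈ U, pairing u x ≤ h x) (hex : ∀ x, ∃ u ∈ U, h x = pairing u x)
    (hpos : ∀ x, x ≠ 0 → 0 < h x) (v w : ℤ × ℤ) (hvw : 0 < det v w) : Reciprocal h v w := by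
  induction hn : (crossing U v w).card using Nat.strong_induction_on generalizing v w with
  | _ n ih =>
  subst hn
  have hv0 : v ≠ 0 := by rintro rfl; simp [det] at hvw
  have hw0 : w ≠ 0 := by rintro rfl; simp [det] at hvw
  rcases (crossing U v w).eq_empty_or_nonempty with he | ⟨⟨p, q⟩, hpq⟩
  -- Without crossings, a functional maximizing the sum of the values at `v` and `w` is maximal at
  -- each of them, so `h` is linear on the cone.
  · obtain ⟨u, hu, hmax⟩ := U.exists_max_image (fun u => pairing u v + pairing u w)
      (by obtain ⟨u, hu, -⟩ := hex 0; exact ⟨u, hu⟩)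
    have hno : ∀ a ∈ U, ∀ b ∈ U, ¬ (pairing a v < pairing b v ∧ pairing b w < pairing a w) := by
      intro a ha b hb hab
      have : (a, b) ∈ crossing U v w := by simp [crossing, ha, hb, hab]
      simp [he] at this
    have hdom : ∀ a ∈ U, pairing a v ≤ pairing u v ∧ pairing a w ≤ pairing u w := by
      intro a ha
      have := hno a ha u hu
      have := hno u hu a ha
      have := hmax a ha
      omega
    refine reciprocal_of_linear (u := u) hvw (fun x h1 h2 => ?_) (hpos v hv0) (hpos w hw0)
    refine le_antisymm ?_ (hle x u hu)
    obtain ⟨a, ha, hax⟩ := hex x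
    rw [hax]
    refine le_of_mul_le_mul_left ?_ hvw
    rw [pairing_mul_det a, pairing_mul_det u]
    exact add_le_add (mul_le_mul_of_nonneg_left (hdom a ha).1 h1)
      (mul_le_mul_of_nonneg_left (hdom a ha).2 h2)
  · have hpq' := hpq
    simp only [crossing, Finset.mem_filter, Finset.mem_product] at hpq'
    obtain ⟨⟨hp, hq⟩, hα, hβ⟩ := hpq'
    -- A positive combination of `v` and `w` on which `p` and `q` agree: cutting there removes `(p,
    -- q)` from both crossing sets and creates no new crossing.
    set z : ℤ × ℤ := (pairing p w - pairing q w) • v + (pairing q v - pairing p v) • w with hz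
    have pz : ∀ u, pairing u z = (pairing p w - pairing q w) * pairing u v +
        (pairing q v - pairing p v) * pairing u w := fun u => by
      simp [hz, pairing]; ring
    have hpqz : pairing p z = pairing q z := by rw [pz, pz]; ring
    have h1 : 0 < det v z := by
      have : det v z = (pairing q v - pairing p v) * det v w := by simp [hz, det]; ring
      rw [this]; exact mul_pos (by linarith) hvw
    have h2 : 0 < det z w := by
      have : det z w = (pairing p w - pairing q w) * det v w := by simp [hz, det]; ring
      rw [this]; exact mul_pos (by linarith) hvw
    have c1 : crossing U v z ⊂ crossing U v w := by
      refine (Finset.ssubset_iff_of_subset ?_).2 ⟨(p, q), hpq, ?_⟩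
      · rintro ⟨a, b⟩ hab
        simp only [crossing, Finset.mem_filter, Finset.mem_product] at hab ⊢
        refine ⟨hab.1, hab.2.1, ?_⟩
        have hz2 := hab.2.2
        rw [pz, pz] at hz2
        by_contra hc
        nlinarith [hab.2.1]
      · simp [crossing, hpqz]
    have c2 : crossing U z w ⊂ crossing U v w := by
      refine (Finset.ssubset_iff_of_subset ?_).2 ⟨(p, q), hpq, ?_⟩
      · rintro ⟨a, b⟩ hab
        simp only [crossing, Finset.mem_filter, Finset.mem_product] at hab ⊢
        refine ⟨hab.1, ?_, hab.2.2⟩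
        have hz2 := hab.2.1
        rw [pz, pz] at hz2
        by_contra hc
        nlinarith [hab.2.2]
      · simp [crossing, hpqz]
    exact Reciprocal.glue hvw h1 h2 (ih _ (Finset.card_lt_card c1) v z h1 rfl)
      (ih _ (Finset.card_lt_card c2) z w h2 rfl)

/-- Ehrhart reciprocity for a maximum of finitely many integral functionals in the plane. -/
theorem exists_quasiQuadratic_reciprocity (U : Finset (ℤ × ℤ)) (h : ℤ × ℤ → ℤ)
    (hle : ∀ x, ∀ u ∈ U, pairing u x ≤ h x) (hex : ∀ x, ∃ u ∈ U, h x = pairing u x)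
    (hpos : ∀ x, x ≠ 0 → 0 < h x) :
    ∃ F : ℤ → ℚ, IsQuasiQuadratic F ∧ (∀ t : ℤ, 0 ≤ t → HasCard {x | h x ≤ t} (F t)) ∧
      ∀ t : ℤ, 0 < t → HasCard {x | h x < t} (F (-t)) := by
  have h0 : h 0 = 0 := by
    obtain ⟨u, -, hu⟩ := hex 0
    simpa [pairing] using hu
  -- The four half-open quadrants partition the nonzero lattice points. The origin is counted
  -- separately, and it satisfies `h 0 < t` only for `t > 0`.
  obtain ⟨F₁, q₁, r₁⟩ := reciprocal_max U h hle hex hpos (1, 0) (0, 1) (by simp [det])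
  obtain ⟨F₂, q₂, r₂⟩ := reciprocal_max U h hle hex hpos (0, 1) (-1, 0) (by simp [det])
  obtain ⟨F₃, q₃, r₃⟩ := reciprocal_max U h hle hex hpos (-1, 0) (0, -1) (by simp [det])
  obtain ⟨F₄, q₄, r₄⟩ := reciprocal_max U h hle hex hpos (0, -1) (1, 0) (by simp [det])
  have hone : HasCard ({0} : Set (ℤ × ℤ)) 1 := ⟨Set.finite_singleton _, by simp⟩
  refine ⟨_, (((IsQuasiQuadratic.const 1).add (q₁.add q₂)).add (q₃.add q₄)),
    fun t ht => ?_, fun t ht => ?_⟩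
  · have := (hone.union ((r₁ t ht).1.union (r₂ t ht).1 ?_) ?_).union
      ((r₃ t ht).1.union (r₄ t ht).1 ?_) ?_
    · convert this using 1
      ext ⟨x, y⟩
      simp only [cone, det, Set.mem_ofPred_eq, Set.mem_union, Set.mem_singleton_iff, Prod.ext_iff,
        Prod.fst_zero, Prod.snd_zero]
      by_cases hxy : x = 0 ∧ y = 0
      · obtain ⟨rfl, rfl⟩ := hxy
        have : h (0, 0) = 0 := h0
        simp [this, ht]
      · generalize h (x, y) = c
        omega
    all_goals
      rw [Set.disjoint_left]
      rintro ⟨x, y⟩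
      simp only [cone, det, Set.mem_ofPred_eq, Set.mem_union, Set.mem_singleton_iff, Prod.ext_iff,
        Prod.fst_zero, Prod.snd_zero]
      omega
  · have := (hone.union ((r₁ t ht.le).2.union (r₂ t ht.le).2 ?_) ?_).union
      ((r₃ t ht.le).2.union (r₄ t ht.le).2 ?_) ?_
    · convert this using 1
      ext ⟨x, y⟩
      simp only [cone, det, Set.mem_ofPred_eq, Set.mem_union, Set.mem_singleton_iff, Prod.ext_iff,
        Prod.fst_zero, Prod.snd_zero]
      by_cases hxy : x = 0 ∧ y = 0
      · obtain ⟨rfl, rfl⟩ := hxy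
        have : h (0, 0) = 0 := h0
        simp [this, ht]
      · generalize h (x, y) = c
        omega
    all_goals
      rw [Set.disjoint_left]
      rintro ⟨x, y⟩
      simp only [cone, det, Set.mem_ofPred_eq, Set.mem_union, Set.mem_singleton_iff, Prod.ext_iff,
        Prod.fst_zero, Prod.snd_zero]
      omega

/-! ### Consequences of a polynomial count -/

/-- If a quasi-quadratic function agrees with a polynomial on the positive integers, then it
agrees with a quadratic polynomial on all integers. -/
theorem IsQuasiQuadratic.eq_quadratic {F : ℤ → ℚ} (hF : IsQuasiQuadratic F) (D : ℤ)
    (q : Polynomial ℝ) (hq : ∀ n : ℤ, 0 < n → ((F (n * D) : ℚ) : ℝ) = q.eval (n : ℝ)) :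
    ∃ a b c : ℝ, ∀ n : ℤ, ((F (n * D) : ℚ) : ℝ) = a * n ^ 2 + b * n + c := by
  obtain ⟨M, hM, hF⟩ := hF
  have key : ∀ r : ℤ, ∃ a b c : ℝ, (∀ m : ℤ, ((F ((r + M * m) * D) : ℚ) : ℝ) = a * m ^ 2 + b * m + c) ∧
      ∀ x : ℝ, q.eval (r + M * x) = a * x ^ 2 + b * x + c := by
    intro r
    obtain ⟨a, b, c, h⟩ := hF (r * D)
    have h1 : ∀ m : ℤ, ((F ((r + M * m) * D) : ℚ) : ℝ) =
        ((a * D ^ 2 : ℚ) : ℝ) * m ^ 2 + ((b * D : ℚ) : ℝ) * m + (c : ℝ) := by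
      intro m
      rw [show (r + M * m) * D = r * D + M * (D * m) by ring, h]
      push_cast; ring
    refine ⟨_, _, _, h1, fun x => ?_⟩
    have hpoly : q.comp (Polynomial.C (r : ℝ) + Polynomial.C (M : ℝ) * Polynomial.X) =
        Polynomial.C ((a * D ^ 2 : ℚ) : ℝ) * Polynomial.X ^ 2 +
        Polynomial.C ((b * D : ℚ) : ℝ) * Polynomial.X + Polynomial.C (c : ℝ) := by
      refine Polynomial.eq_of_infinite_eval_eq _ _ ?_
      -- For `m > |r|` the argument `r + M * m` is positive, so `hq` gives infinitely many
      -- agreements.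
      refine Set.Infinite.mono (s := (fun m : ℤ => (m : ℝ)) '' Set.Ioi |r|) ?_
        ((Set.Ioi_infinite _).image Int.cast_injective.injOn)
      rintro _ ⟨m, hm, rfl⟩
      have hm' : |r| < m := hm
      have hpos : 0 < r + M * m := by
        have := neg_abs_le r
        nlinarith [abs_nonneg r]
      have := hq _ hpos
      rw [h1] at this
      simp only [Set.mem_ofPred_eq, Polynomial.eval_comp, Polynomial.eval_add, Polynomial.eval_mul,
        Polynomial.eval_C, Polynomial.eval_X, Polynomial.eval_pow]
      rw [this]; push_cast; rfl
    have := congrArg (Polynomial.eval x) hpoly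
    simpa only [Polynomial.eval_comp, Polynomial.eval_add, Polynomial.eval_mul,
        Polynomial.eval_C, Polynomial.eval_X, Polynomial.eval_pow] using this
  have hFq : ∀ n : ℤ, ((F (n * D) : ℚ) : ℝ) = q.eval (n : ℝ) := by
    intro n
    obtain ⟨a, b, c, h1, h2⟩ := key n
    have e1 := h1 0
    have e2 := h2 0
    simp at e1 e2
    rw [e1, e2]
  obtain ⟨a, b, c, -, h2⟩ := key 0
  refine ⟨a / M ^ 2, b / M, c, fun n => ?_⟩
  have hM' : (M : ℝ) ≠ 0 := by exact_mod_cast hM.ne'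
  have := h2 (n / M)
  rw [Int.cast_zero, zero_add, mul_div_cancel₀ _ hM'] at this
  rw [hFq, this]
  field_simp

/-- If the number of lattice points with `h x ≤ n * D` is a polynomial in `n`, and the origin is
the only one with `h x < D`, then all values of `h` are multiples of `D`. -/
theorem dvd_of_polynomial_count (U : Finset (ℤ × ℤ)) (h : ℤ × ℤ → ℤ)
    (hle : ∀ x, ∀ u ∈ U, pairing u x ≤ h x) (hex : ∀ x, ∃ u ∈ U, h x = pairing u x)
    (hpos : ∀ x, x ≠ 0 → 0 < h x) {D : ℤ} (hD : 0 < D) (q : Polynomial ℝ)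
    (hq : ∀ n : ℤ, 0 < n → ({x | h x ≤ n * D}.ncard : ℝ) = q.eval (n : ℝ))
    (hint : ∀ x, h x < D → x = 0) (x : ℤ × ℤ) : D ∣ h x := by
  have h0 : h 0 = 0 := by
    obtain ⟨u, -, hu⟩ := hex 0
    simpa [pairing] using hu
  have hnn : ∀ x, 0 ≤ h x := fun x => by
    by_cases hx : x = 0
    · rw [hx, h0]
    · exact (hpos x hx).le
  obtain ⟨F, hF, hle', hlt⟩ := exists_quasiQuadratic_reciprocity U h hle hex hpos
  obtain ⟨a, b, c, habc⟩ := hF.eq_quadratic D q fun n hn => by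
    rw [← hq n hn, ← (hle' (n * D) (by positivity)).2]; simp
  have s0 : {x | h x ≤ 0} = {0} := by
    ext y
    simp only [Set.mem_ofPred_eq, Set.mem_singleton_iff]
    constructor
    · intro hy
      by_contra hc
      exact absurd (hpos y hc) (not_lt.2 hy)
    · rintro rfl; exact h0.le
  have s1 : {x | h x < D} = {0} := by
    ext y
    simp only [Set.mem_ofPred_eq, Set.mem_singleton_iff]
    constructor
    · exact hint y
    · rintro rfl; rw [h0]; exact hD
  have f0 : F 0 = 1 := by
    rw [← (hle' 0 le_rfl).2, s0]; simp
  have f1 : F (-D) = 1 := by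
    rw [← (hlt D hD).2, s1]; simp
  -- Compare the values at `n = 0` and `n = -1`, both equal to `1`.
  have hab : a = b := by
    have e0 := habc 0
    have e1 := habc (-1)
    rw [zero_mul, f0] at e0
    rw [neg_one_mul, f1] at e1
    push_cast at e0 e1
    linarith
  subst hab
  set n := h x / D with hn
  have hn0 : 0 ≤ n := Int.ediv_nonneg (hnn x) hD.le
  have hcard : {y | h y < (n + 1) * D}.ncard = {y | h y ≤ n * D}.ncard := by
    have e1 := (hlt ((n + 1) * D) (by positivity)).2
    have e2 := (hle' (n * D) (by positivity)).2
    have e3 : F (-((n + 1) * D)) = F (n * D) := by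
      have i1 := habc (-(n + 1))
      have i2 := habc n
      rw [neg_mul] at i1
      have : ((F (-((n + 1) * D)) : ℚ) : ℝ) = (F (n * D) : ℚ) := by
        rw [i1, i2]; push_cast; ring
      exact_mod_cast this
    rw [← e1, ← e2] at e3
    exact_mod_cast e3
  have hsub : {y | h y ≤ n * D} ⊆ {y | h y < (n + 1) * D} := by
    intro y hy
    simp only [Set.mem_ofPred_eq] at hy ⊢
    linarith
  have heq := Set.eq_of_subset_of_ncard_le hsub hcard.le (hlt ((n + 1) * D) (by positivity)).1
  have hx : x ∈ {y | h y ≤ n * D} := by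
    rw [heq]
    exact Int.lt_ediv_add_one_mul_self (h x) hD
  exact ⟨n, by
    rw [mul_comm]
    exact le_antisymm hx (Int.ediv_mul_le _ hD.ne')⟩

/-! ### Polar duality and translation by lattice points -/

theorem inner_eq_coords (x y : EuclideanSpace ℝ (Fin 2)) :
    inner ℝ x y = x 0 * y 0 + x 1 * y 1 := by
  simp [PiLp.inner_apply, Fin.sum_univ_two, mul_comm]

theorem exists_inner_eq {d : ℕ} (f : StrongDual ℝ (EuclideanSpace ℝ (Fin d))) :
    ∃ u : EuclideanSpace ℝ (Fin d), ∀ x, f x = inner ℝ u x :=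
  ⟨(InnerProductSpace.toDual ℝ _).symm f, fun _ => InnerProductSpace.toDual_symm_apply.symm⟩

theorem inner_left_le_of_mem_convexHull {d : ℕ} {W : Set (EuclideanSpace ℝ (Fin d))}
    {x u : EuclideanSpace ℝ (Fin d)} {c : ℝ} (h : ∀ w ∈ W, inner ℝ w x ≤ c)
    (hu : u ∈ convexHull ℝ W) : inner ℝ u x ≤ c := by
  have hconv : Convex ℝ {y : EuclideanSpace ℝ (Fin d) | inner ℝ y x ≤ c} := by
    refine convex_halfSpace_le ⟨fun y z => inner_add_left y z x, fun r y => ?_⟩ c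
    rw [real_inner_smul_left, smul_eq_mul]
  exact convexHull_min h hconv hu

theorem convex_polarDual {d : ℕ} (S : Set (EuclideanSpace ℝ (Fin d))) :
    Convex ℝ (polarDual S) := by
  intro x hx y hy a b ha hb hab s hs
  rw [inner_add_left, real_inner_smul_left, real_inner_smul_left]
  nlinarith [hx s hs, hy s hs]

theorem isClosed_polarDual {d : ℕ} (S : Set (EuclideanSpace ℝ (Fin d))) :
    IsClosed (polarDual S) := by
  have : polarDual S = ⋂ s ∈ S, {x | inner ℝ x s ≤ 1} := by
    ext x; simp [polarDual]
  rw [this]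
  exact isClosed_biInter fun s _ => isClosed_le (by fun_prop) continuous_const

theorem polarDual_convexHull {d : ℕ} (S : Set (EuclideanSpace ℝ (Fin d))) :
    polarDual (convexHull ℝ S) = polarDual S := by
  refine Set.Subset.antisymm (fun x hx s hs => hx s (subset_convexHull ℝ S hs)) fun x hx s hs => ?_
  rw [real_inner_comm]
  exact inner_left_le_of_mem_convexHull (fun w hw => by rw [real_inner_comm]; exact hx w hw) hs

theorem isCompact_polarDual {d : ℕ} {Q : Set (EuclideanSpace ℝ (Fin d))}
    (h0 : (0 : EuclideanSpace ℝ (Fin d)) ∈ interior Q) : IsCompact (polarDual Q) := by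
  refine Metric.isCompact_of_isClosed_isBounded (isClosed_polarDual Q) ?_
  obtain ⟨r, hr, hball⟩ := Metric.isOpen_iff.1 isOpen_interior 0 h0
  refine (Metric.isBounded_iff_subset_closedBall 0).2 ⟨2 / r, fun u hu => ?_⟩
  rw [mem_closedBall_zero_iff]
  by_cases hu0 : u = 0
  · rw [hu0, norm_zero]; positivity
  have hn : 0 < ‖u‖ := norm_pos_iff.2 hu0
  have hmem : (r / 2 / ‖u‖) • u ∈ Q := by
    refine interior_subset (hball ?_)
    rw [mem_ball_zero_iff, norm_smul, Real.norm_of_nonneg (by positivity),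
      div_mul_cancel₀ _ hn.ne']
    linarith
  have := hu _ hmem
  rw [real_inner_smul_right, real_inner_self_eq_norm_sq] at this
  rw [le_div_iff₀ hr]
  field_simp at this
  linarith

/-- Otherwise a hyperplane through the origin bounds `Q`, and its normal spans a ray inside the
polar. -/
theorem zero_mem_interior_of_isBounded_polarDual {d : ℕ} {Q : Set (EuclideanSpace ℝ (Fin d))}
    (hQ : Convex ℝ Q) (hne : (interior Q).Nonempty) (hb : Bornology.IsBounded (polarDual Q)) :
    (0 : EuclideanSpace ℝ (Fin d)) ∈ interior Q := by
  by_contra h0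
  obtain ⟨f, hf⟩ := geometric_hahn_banach_open_point hQ.interior isOpen_interior h0
  obtain ⟨u, hu⟩ := exists_inner_eq f
  simp only [hu, inner_zero_right] at hf
  obtain ⟨y, hy⟩ := hne
  have hu0 : 0 < ‖u‖ := by
    rw [norm_pos_iff]
    rintro rfl
    simpa using hf y hy
  have hQ' : ∀ x ∈ Q, inner ℝ u x ≤ 0 := by
    intro x hx
    have hx' : x ∈ closure (interior Q) := by
      rw [hQ.closure_interior_eq_closure_of_nonempty_interior ⟨y, hy⟩]; exact subset_closure hx
    have hcl : IsClosed {x : EuclideanSpace ℝ (Fin d) | inner ℝ u x ≤ 0} :=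
      isClosed_le (by fun_prop) continuous_const
    exact closure_minimal (fun z hz => (hf z hz).le) hcl hx'
  obtain ⟨R, hR⟩ := (Metric.isBounded_iff_subset_closedBall 0).1 hb
  have hmem : ((|R| + 1) / ‖u‖) • u ∈ polarDual Q := by
    intro x hx
    rw [real_inner_smul_left]
    have : 0 ≤ (|R| + 1) / ‖u‖ := by positivity
    nlinarith [hQ' x hx]
  have := hR hmem
  rw [mem_closedBall_zero_iff, norm_smul, Real.norm_of_nonneg (by positivity),
    div_mul_cancel₀ _ hu0.ne'] at this
  linarith [le_abs_self R]

/-- Bipolar theorem: a functional separating `x` from `Q`, normalized to level `1`, lies in the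
polar. -/
theorem mem_iff_of_polarDual_eq {d : ℕ} {Q W : Set (EuclideanSpace ℝ (Fin d))} (hQ : Convex ℝ Q)
    (hc : IsClosed Q) (h0 : (0 : EuclideanSpace ℝ (Fin d)) ∈ Q)
    (hW : polarDual Q = convexHull ℝ W) (x : EuclideanSpace ℝ (Fin d)) :
    x ∈ Q ↔ ∀ u ∈ W, inner ℝ u x ≤ 1 := by
  constructor
  · intro hx u hu
    have : u ∈ polarDual Q := hW ▸ subset_convexHull ℝ W hu
    exact this x hx
  · intro h
    by_contra hx
    obtain ⟨f, c, hfc, hcx⟩ := geometric_hahn_banach_closed_point hQ hc hx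
    obtain ⟨u, hu⟩ := exists_inner_eq f
    simp only [hu] at hfc hcx
    have hcpos : 0 < c := by simpa using hfc 0 h0
    have hmem : c⁻¹ • u ∈ polarDual Q := by
      intro y hy
      rw [real_inner_smul_left, inv_mul_le_iff₀ hcpos, mul_one]
      exact (hfc y hy).le
    rw [hW] at hmem
    have := inner_left_le_of_mem_convexHull h hmem
    rw [real_inner_smul_left, inv_mul_le_iff₀ hcpos, mul_one] at this
    linarith

/-- An interior point can be stretched slightly within `Q`, so no constraint is active there.
Conversely, finitely many strict inequalities define an open set. -/
theorem mem_interior_iff_of_forall_inner_le {d : ℕ} {Q W : Set (EuclideanSpace ℝ (Fin d))}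
    (hW : W.Finite) (h : ∀ x, x ∈ Q ↔ ∀ u ∈ W, inner ℝ u x ≤ 1)
    (x : EuclideanSpace ℝ (Fin d)) : x ∈ interior Q ↔ ∀ u ∈ W, inner ℝ u x < 1 := by
  constructor
  · intro hx u hu
    have hopen : IsOpen {t : ℝ | t • x ∈ interior Q} :=
      isOpen_interior.preimage (f := fun t : ℝ => t • x) (by fun_prop)
    obtain ⟨ε, hε, hb⟩ := Metric.isOpen_iff.1 hopen 1 (by simpa using hx)
    have hm : (1 + ε / 2) • x ∈ Q := by
      refine interior_subset (hb ?_)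
      rw [Metric.mem_ball, Real.dist_eq, add_sub_cancel_left, abs_of_pos (by positivity)]
      linarith
    have := (h _).1 hm u hu
    rw [real_inner_smul_right] at this
    by_contra hc
    nlinarith
  · intro hx
    have hopen : IsOpen (⋂ u ∈ W, {y : EuclideanSpace ℝ (Fin d) | inner ℝ u y < 1}) :=
      hW.isOpen_biInter fun u _ => isOpen_lt (by fun_prop) continuous_const
    refine interior_maximal (fun y hy => (h y).2 fun u hu => ?_) hopen (by simpa using hx)
    have hy' := Set.mem_iInter₂.1 hy u hu
    exact le_of_lt hy'

/-- A nonzero such `x` would span a ray inside the bounded set `Q`. -/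
theorem eq_zero_of_forall_inner_nonpos {d : ℕ} {Q W : Set (EuclideanSpace ℝ (Fin d))}
    (hb : Bornology.IsBounded Q) (h : ∀ x, x ∈ Q ↔ ∀ u ∈ W, inner ℝ u x ≤ 1)
    {x : EuclideanSpace ℝ (Fin d)} (hx : ∀ u ∈ W, inner ℝ u x ≤ 0) : x = 0 := by
  by_contra hx0
  have hn : 0 < ‖x‖ := norm_pos_iff.2 hx0
  obtain ⟨R, hR⟩ := (Metric.isBounded_iff_subset_closedBall 0).1 hb
  have hmem : ((|R| + 1) / ‖x‖) • x ∈ Q := by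
    rw [h]
    intro u hu
    rw [real_inner_smul_right]
    have : 0 ≤ (|R| + 1) / ‖x‖ := by positivity
    nlinarith [hx u hu]
  have := hR hmem
  rw [mem_closedBall_zero_iff, norm_smul, Real.norm_of_nonneg (by positivity),
    div_mul_cancel₀ _ hn.ne'] at this
  linarith [le_abs_self R]

theorem inner_latticePoints {d : ℕ} {x y : EuclideanSpace ℝ (Fin d)} (hx : x ∈ latticePoints d)
    (hy : y ∈ latticePoints d) : ∃ m : ℤ, inner ℝ x y = (m : ℝ) := by
  choose a ha using hx
  choose b hb using hy
  refine ⟨∑ i, b i * a i, ?_⟩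
  simp [PiLp.inner_apply, ha, hb]

theorem sub_image_convexHull {d : ℕ} (p : EuclideanSpace ℝ (Fin d))
    (V : Set (EuclideanSpace ℝ (Fin d))) :
    (fun x => x - p) '' convexHull ℝ V = convexHull ℝ ((fun x => x - p) '' V) := by
  simp only [sub_eq_add_neg, ← Set.add_singleton]
  simpa [Set.add_singleton, sub_eq_add_neg] using (convexHull_add V {-p}).symm

theorem mem_interior_sub_image {d : ℕ} (p x : EuclideanSpace ℝ (Fin d))
    (P : Set (EuclideanSpace ℝ (Fin d))) :
    x - p ∈ interior ((fun x => x - p) '' P) ↔ x ∈ interior P := by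
  have := (Homeomorph.subRight p).image_interior P
  rw [show (fun x => x - p) '' P = (Homeomorph.subRight p) '' P from rfl, ← this]
  exact (Homeomorph.subRight p).injective.mem_set_image

theorem sub_mem_latticePoints {d : ℕ} {x y : EuclideanSpace ℝ (Fin d)} (hx : x ∈ latticePoints d)
    (hy : y ∈ latticePoints d) : x - y ∈ latticePoints d := by
  intro i
  obtain ⟨a, ha⟩ := hx i
  obtain ⟨b, hb⟩ := hy i
  exact ⟨a - b, by simp [ha, hb]⟩

/-! ### Dual-integral polytopes have one interior lattice point -/

theorem IsDualIntegral.existsUnique_interior {d : ℕ} {P : Set (EuclideanSpace ℝ (Fin d))}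
    (hne : (interior P).Nonempty) (h : IsDualIntegral P) :
    ∃! p : EuclideanSpace ℝ (Fin d), p ∈ interior P ∧ p ∈ latticePoints d := by
  obtain ⟨⟨V, hV, rfl⟩, p, hp, W, hWfin, hWlat, hW⟩ := h
  have hQeq := sub_image_convexHull p V
  set Q := (fun x => x - p) '' convexHull ℝ V with hQ
  have hVfin : ((fun x => x - p) '' V).Finite := hV.image _
  have hconv : Convex ℝ Q := hQeq ▸ convex_convexHull ℝ _
  have hcomp : IsCompact Q := hQeq ▸ hVfin.isCompact_convexHull ℝ
  have hneQ : (interior Q).Nonempty := by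
    obtain ⟨y, hy⟩ := hne
    exact ⟨y - p, (mem_interior_sub_image p y _).2 hy⟩
  have h0 := zero_mem_interior_of_isBounded_polarDual hconv hneQ
    (hW ▸ (hWfin.isCompact_convexHull ℝ).isBounded)
  have hmem := mem_iff_of_polarDual_eq hconv hcomp.isClosed (interior_subset h0) hW
  have hint := mem_interior_iff_of_forall_inner_le hWfin hmem
  refine ⟨p, ⟨?_, hp⟩, ?_⟩
  · rw [← mem_interior_sub_image p p, sub_self]; exact h0
  · rintro x ⟨hx, hxl⟩
    rw [← mem_interior_sub_image p x, hint] at hx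
    refine sub_eq_zero.1 (eq_zero_of_forall_inner_nonpos hcomp.isBounded hmem fun u hu => ?_)
    obtain ⟨m, hm⟩ := inner_latticePoints (hWlat hu) (sub_mem_latticePoints hxl hp)
    have := hx u hu
    rw [hm] at this ⊢
    have h1 : m < 1 := by exact_mod_cast this
    exact_mod_cast Int.lt_add_one_iff.1 h1

theorem interior_nonempty_of_affineDim {d : ℕ} {P : Set (EuclideanSpace ℝ (Fin d))}
    (hP : IsConvexPolytope P) (hne : P.Nonempty) (hdim : affineDim P = d) :
    (interior P).Nonempty := by
  obtain ⟨V, -, rfl⟩ := hP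
  rw [(convex_convexHull ℝ V).interior_nonempty_iff_affineSpan_eq_top,
    AffineSubspace.affineSpan_eq_top_iff_vectorSpan_eq_top_of_nonempty _ _ _ hne]
  exact Submodule.eq_top_of_finrank_eq (by rw [finrank_euclideanSpace_fin]; exact hdim)

/-! ### Vertices of the polar polygon and their rationality -/

/-- An extreme point of the polar of a finite planar set is determined by two active
constraints. -/
theorem exists_active_of_mem_extremePoints {V : Set (EuclideanSpace ℝ (Fin 2))} (hV : V.Finite)
    {u : EuclideanSpace ℝ (Fin 2)} (hu : u ∈ (polarDual V).extremePoints ℝ) :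
    ∃ a ∈ V, ∃ b ∈ V, inner ℝ u a = 1 ∧ inner ℝ u b = 1 ∧ a 0 * b 1 - a 1 * b 0 ≠ 0 := by
  have huV := hu.1
  -- If all active constraints vanished on `e`, then `u ± t e` would stay in the polar for small
  -- `t`, against extremality.
  have key : ∀ e : EuclideanSpace ℝ (Fin 2), e ≠ 0 → ∃ a ∈ V, inner ℝ u a = 1 ∧ inner ℝ e a ≠ 0 := by
    intro e he
    by_contra! hcon
    have hev : ∀ᶠ t : ℝ in nhds 0, ∀ s ∈ V, inner ℝ (u + t • e) s ≤ 1 := by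
      rw [Filter.eventually_all_finite hV]
      intro s hs
      simp only [inner_add_left, real_inner_smul_left]
      by_cases h1 : inner ℝ u s = 1
      · simp [h1, hcon s hs h1]
      · have hlt : inner ℝ u s < 1 := lt_of_le_of_ne (huV s hs) h1
        have hcont : Continuous fun t : ℝ => inner ℝ u s + t * inner ℝ e s := by fun_prop
        filter_upwards [hcont.continuousAt.eventually_lt continuousAt_const
          (by simpa using hlt : inner ℝ u s + (0 : ℝ) * inner ℝ e s < 1)] with t ht
        exact ht.le
    obtain ⟨ε, hε, hb⟩ := Metric.eventually_nhds_iff.1 hev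
    have m1 : u + (ε / 2) • e ∈ polarDual V := hb (by
      rw [Real.dist_eq, sub_zero, abs_of_pos (by positivity)]; linarith)
    have m2 : u + (-(ε / 2)) • e ∈ polarDual V := hb (by
      rw [Real.dist_eq, sub_zero, abs_neg, abs_of_pos (by positivity)]; linarith)
    have := hu.2 m1 m2 ⟨1 / 2, 1 / 2, by norm_num, by norm_num, by norm_num, by module⟩
    have h2 : (ε / 2) • e = 0 := by simpa using this
    rcases smul_eq_zero.1 h2 with h3 | h3
    · linarith
    · exact he h3
  obtain ⟨a, haV, ha, ha'⟩ := key (!₂[1, 0]) (fun h => by simpa using congrArg (fun x => x 0) h)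
  have ha0 : a ≠ 0 := by rintro rfl; simp at ha'
  -- The direction is orthogonal to `a`, so the constraint found is not parallel to `a`.
  obtain ⟨b, hbV, hb, hb'⟩ := key (!₂[-a 1, a 0]) (fun h => ha0 (by
    have h0 := congrArg (fun x => x 0) h
    have h1 := congrArg (fun x => x 1) h
    simp at h0 h1
    ext i; fin_cases i <;> simp [h0, h1]))
  refine ⟨a, haV, b, hbV, ha, hb, fun hd => hb' ?_⟩
  rw [inner_eq_coords]
  simp
  linarith

theorem eq_cramer {u a b : EuclideanSpace ℝ (Fin 2)} (ha : inner ℝ u a = 1) (hb : inner ℝ u b = 1)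
    (hd : a 0 * b 1 - a 1 * b 0 ≠ 0) :
    u = !₂[(b 1 - a 1) / (a 0 * b 1 - a 1 * b 0), (a 0 - b 0) / (a 0 * b 1 - a 1 * b 0)] := by
  rw [inner_eq_coords] at ha hb
  ext i
  fin_cases i
  · simp
    rw [eq_div_iff hd]; linear_combination b 1 * ha - a 1 * hb
  · simp
    rw [eq_div_iff hd]; linear_combination a 0 * hb - b 0 * ha

theorem finite_extremePoints_polarDual {V : Set (EuclideanSpace ℝ (Fin 2))} (hV : V.Finite) :
    ((polarDual V).extremePoints ℝ).Finite := by
  refine ((hV.prod hV).image fun ab : EuclideanSpace ℝ (Fin 2) × EuclideanSpace ℝ (Fin 2) =>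
    (!₂[(ab.2 1 - ab.1 1) / (ab.1 0 * ab.2 1 - ab.1 1 * ab.2 0),
      (ab.1 0 - ab.2 0) / (ab.1 0 * ab.2 1 - ab.1 1 * ab.2 0)] :
      EuclideanSpace ℝ (Fin 2))).subset fun u hu => ?_
  obtain ⟨a, ha, b, hb, h1, h2, h3⟩ := exists_active_of_mem_extremePoints hV hu
  exact ⟨(a, b), ⟨ha, hb⟩, (eq_cramer h1 h2 h3).symm⟩

theorem extremePoints_polarDual_subset_rationalPoints {V : Set (EuclideanSpace ℝ (Fin 2))}
    (hV : V.Finite) (hVr : V ⊆ rationalPoints 2) :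
    (polarDual V).extremePoints ℝ ⊆ rationalPoints 2 := by
  intro u hu
  obtain ⟨a, ha, b, hb, h1, h2, h3⟩ := exists_active_of_mem_extremePoints hV hu
  obtain ⟨a0, e0⟩ := hVr ha 0
  obtain ⟨a1, e1⟩ := hVr ha 1
  obtain ⟨b0, f0⟩ := hVr hb 0
  obtain ⟨b1, f1⟩ := hVr hb 1
  rw [eq_cramer h1 h2 h3, e0, e1, f0, f1]
  intro i
  fin_cases i
  · exact ⟨(b1 - a1) / (a0 * b1 - a1 * b0), by simp⟩
  · exact ⟨(a0 - b0) / (a0 * b1 - a1 * b0), by simp⟩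

theorem polarDual_eq_convexHull_extremePoints {V : Set (EuclideanSpace ℝ (Fin 2))} (hV : V.Finite)
    (h0 : (0 : EuclideanSpace ℝ (Fin 2)) ∈ interior (convexHull ℝ V)) :
    polarDual V = convexHull ℝ ((polarDual V).extremePoints ℝ) := by
  have hc : IsCompact (polarDual V) := polarDual_convexHull V ▸ isCompact_polarDual h0
  conv_lhs => rw [← closure_convexHull_extremePoints hc (convex_polarDual V)]
  exact ((finite_extremePoints_polarDual hV).isClosed_convexHull ℝ).closure_eq

/-- A finite set of rational points has a common denominator. -/
theorem exists_common_denominator {W : Set (EuclideanSpace ℝ (Fin 2))} (hW : W.Finite)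
    (hWr : W ⊆ rationalPoints 2) :
    ∃ D : ℤ, 0 < D ∧ ∀ u ∈ W, ∃ c : ℤ × ℤ, (c.1 : ℝ) = D * u 0 ∧ (c.2 : ℝ) = D * u 1 := by
  induction W, hW using Set.Finite.induction_on with
  | empty => exact ⟨1, one_pos, by simp⟩
  | @insert a W _ _ ih =>
    obtain ⟨D, hD, h⟩ := ih ((Set.subset_insert _ _).trans hWr)
    obtain ⟨q, hq⟩ := hWr (Set.mem_insert _ _) 0
    obtain ⟨r, hr⟩ := hWr (Set.mem_insert _ _) 1
    have hqd : 0 < (q.den : ℤ) := by exact_mod_cast q.den_pos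
    have hrd : 0 < (r.den : ℤ) := by exact_mod_cast r.den_pos
    have eq1 : (q : ℝ) * q.den = q.num := by exact_mod_cast Rat.mul_den_eq_num q
    have er1 : (r : ℝ) * r.den = r.num := by exact_mod_cast Rat.mul_den_eq_num r
    refine ⟨D * q.den * r.den, by positivity, ?_⟩
    rintro u (rfl | hu)
    · refine ⟨(D * r.den * q.num, D * q.den * r.num), ?_, ?_⟩
      · rw [hq]; push_cast; rw [← eq1]; ring
      · rw [hr]; push_cast; rw [← er1]; ring
    · obtain ⟨c, h1, h2⟩ := h u hu
      refine ⟨(q.den * r.den * c.1, q.den * r.den * c.2), ?_, ?_⟩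
      · push_cast; rw [h1]; ring
      · push_cast; rw [h2]; ring

/-! ### From one interior lattice point to an integral polar -/

/-- The vector in the Euclidean plane with the given integer coordinates. -/
noncomputable def toPlane (x : ℤ × ℤ) : EuclideanSpace ℝ (Fin 2) := !₂[(x.1 : ℝ), (x.2 : ℝ)]

theorem toPlane_injective : Function.Injective toPlane := by
  intro x y h
  have h0 := congrArg (fun v => v 0) h
  have h1 := congrArg (fun v => v 1) h
  simp [toPlane] at h0 h1
  exact Prod.ext h0 h1

theorem toPlane_mem_latticePoints (x : ℤ × ℤ) : toPlane x ∈ latticePoints 2 := by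
  intro i
  fin_cases i
  · exact ⟨x.1, by simp [toPlane]⟩
  · exact ⟨x.2, by simp [toPlane]⟩

theorem exists_toPlane_eq {y : EuclideanSpace ℝ (Fin 2)} (hy : y ∈ latticePoints 2) :
    ∃ x, toPlane x = y := by
  obtain ⟨a, ha⟩ := hy 0
  obtain ⟨b, hb⟩ := hy 1
  refine ⟨(a, b), ?_⟩
  ext i; fin_cases i <;> simp [toPlane, ha, hb]

theorem inner_toPlane_of_scaled {D : ℤ} {u : EuclideanSpace ℝ (Fin 2)} {c : ℤ × ℤ}
    (h1 : (c.1 : ℝ) = D * u 0) (h2 : (c.2 : ℝ) = D * u 1) (x : ℤ × ℤ) :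
    (pairing c x : ℝ) = D * inner ℝ u (toPlane x) := by
  rw [inner_eq_coords]
  simp only [pairing, toPlane]
  push_cast
  rw [h1, h2]
  simp; ring

/-- The lattice points of the `n`-th dilate, translated by `n • p`, are given by the inequalities
of `P - p`. -/
theorem latticeCount_eq_ncard {P : Set (EuclideanSpace ℝ (Fin 2))} {p : EuclideanSpace ℝ (Fin 2)}
    (hp : p ∈ latticePoints 2) {U : Set (EuclideanSpace ℝ (Fin 2))}
    (h : ∀ x, x ∈ (fun x => x - p) '' P ↔ ∀ u ∈ U, inner ℝ u x ≤ 1) {n : ℕ} (hn : 0 < n) :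
    latticeCount P n = {x : ℤ × ℤ | ∀ u ∈ U, inner ℝ u (toPlane x) ≤ n}.ncard := by
  have hn' : (0 : ℝ) < n := by exact_mod_cast hn
  have hinj : Function.Injective fun x => toPlane x + (n : ℝ) • p := fun x y hxy =>
    toPlane_injective (by simpa using hxy)
  have hmem : ∀ y : EuclideanSpace ℝ (Fin 2), y + (n : ℝ) • p ∈ (n : ℝ) • P ↔
      ∀ u ∈ U, inner ℝ u y ≤ n := by
    intro y
    have : y + (n : ℝ) • p ∈ (n : ℝ) • P ↔ (n : ℝ)⁻¹ • y ∈ (fun x => x - p) '' P := by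
      rw [Set.mem_smul_set_iff_inv_smul_mem₀ hn'.ne', smul_add, inv_smul_smul₀ hn'.ne']
      constructor
      · exact fun hy => ⟨_, hy, by simp⟩
      · rintro ⟨z, hz, hzy⟩
        rw [← hzy]; simpa using hz
    rw [this, h]
    refine forall₂_congr fun u _ => ?_
    rw [real_inner_smul_right, inv_mul_le_iff₀ hn', mul_one]
  have hnp : (n : ℝ) • p ∈ latticePoints 2 := fun i => by
    obtain ⟨a, ha⟩ := hp i
    exact ⟨n * a, by simp [ha]⟩
  rw [latticeCount, ← Set.ncard_image_of_injective _ hinj]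
  congr 1
  ext y
  simp only [Set.mem_inter_iff, Set.mem_image, Set.mem_ofPred_eq]
  constructor
  · rintro ⟨h1, h2⟩
    obtain ⟨x, hx⟩ := exists_toPlane_eq (sub_mem_latticePoints h2 hnp)
    refine ⟨x, ?_, by rw [hx]; simp⟩
    rw [hx, ← hmem]; simpa using h1
  · rintro ⟨x, hx, rfl⟩
    refine ⟨(hmem _).2 hx, fun i => ?_⟩
    obtain ⟨a, ha⟩ := toPlane_mem_latticePoints x i
    obtain ⟨b, hb⟩ := hnp i
    exact ⟨a + b, by rw [PiLp.add_apply, ha, hb]; simp⟩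

/-- A rational planar cone contains a lattice point together with its two coordinate
neighbours. -/
theorem exists_latticePoint_neighbours {a b : EuclideanSpace ℝ (Fin 2)}
    (ha : a ∈ rationalPoints 2) (hb : b ∈ rationalPoints 2) (hd : a 0 * b 1 - a 1 * b 0 ≠ 0) :
    ∃ z : ℤ × ℤ, ∀ e ∈ ({0, (1, 0), (0, 1)} : Set (ℤ × ℤ)), ∃ s t : ℝ, 0 ≤ s ∧ 0 ≤ t ∧
      toPlane (z + e) = s • a + t • b := by
  obtain ⟨D, hD, hDc⟩ := exists_common_denominator (W := {a, b}) (by simp)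
    (by rintro x (rfl | rfl) <;> assumption)
  obtain ⟨c, c0, c1⟩ := hDc a (by simp)
  obtain ⟨c', d0, d1⟩ := hDc b (by simp)
  set δ := a 0 * b 1 - a 1 * b 0 with hδ
  -- The point is `z = kD(a + b)`. The Cramer coefficients of the unit vectors are at most `k` in
  -- absolute value, so adding them keeps both coordinates nonnegative.
  obtain ⟨k, hk⟩ := exists_nat_ge (|b 1 / δ| + |a 1 / δ| + |b 0 / δ| + |a 0 / δ|)
  have hD1 : (1 : ℝ) ≤ D := by exact_mod_cast hD
  have hkD : (k : ℝ) ≤ k * D := le_mul_of_one_le_right (Nat.cast_nonneg _) hD1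
  have n1 := abs_nonneg (b 1 / δ)
  have n2 := abs_nonneg (a 1 / δ)
  have n3 := abs_nonneg (b 0 / δ)
  have n4 := abs_nonneg (a 0 / δ)
  have hz : ∀ e : ℤ × ℤ, ∀ s t : ℝ, s * a 0 + t * b 0 = e.1 → s * a 1 + t * b 1 = e.2 →
      toPlane ((k * (c.1 + c'.1), k * (c.2 + c'.2)) + e) =
        (k * D + s) • a + (k * D + t) • b := by
    intro e s t h0 h1
    ext i
    fin_cases i
    · simp [toPlane, c0, d0, ← h0]; ring
    · simp [toPlane, c1, d1, ← h1]; ring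
  refine ⟨(k * (c.1 + c'.1), k * (c.2 + c'.2)), ?_⟩
  rintro e (rfl | rfl | rfl)
  · exact ⟨_, _, by linarith, by linarith, hz 0 0 0 (by simp) (by simp)⟩
  · refine ⟨_, _, ?_, ?_, hz (1, 0) (b 1 / δ) (-(a 1 / δ)) ?_ ?_⟩
    · linarith [neg_abs_le (b 1 / δ)]
    · linarith [le_abs_self (a 1 / δ)]
    · field_simp; simp [hδ]; ring
    · field_simp; simp
  · refine ⟨_, _, ?_, ?_, hz (0, 1) (-(b 0 / δ)) (a 0 / δ) ?_ ?_⟩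
    · linarith [le_abs_self (b 0 / δ)]
    · linarith [neg_abs_le (a 0 / δ)]
    · field_simp; simp
    · field_simp; simp [hδ]; ring

theorem IsQuasiLattice.isDualIntegral {P : Set (EuclideanSpace ℝ (Fin 2))} (hP : IsQuasiLattice P)
    {p : EuclideanSpace ℝ (Fin 2)} (hpP : p ∈ interior P) (hp : p ∈ latticePoints 2)
    (huniq : ∀ x ∈ interior P, x ∈ latticePoints 2 → x = p) : IsDualIntegral P := by
  obtain ⟨⟨V₀, hV₀, hV₀r, rfl⟩, q, -, hq⟩ := hP
  refine ⟨⟨V₀, hV₀, rfl⟩, p, hp, ?_⟩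
  have hQeq := sub_image_convexHull p V₀
  set V := (fun x => x - p) '' V₀ with hVdef
  have hV : V.Finite := hV₀.image _
  have hVr : V ⊆ rationalPoints 2 := by
    rintro _ ⟨v, hv, rfl⟩ i
    obtain ⟨r, hr⟩ := hV₀r hv i
    obtain ⟨m, hm⟩ := hp i
    exact ⟨r - m, by simp [hr, hm]⟩
  have h0 : (0 : EuclideanSpace ℝ (Fin 2)) ∈ interior (convexHull ℝ V) := by
    rw [← hQeq, ← sub_self p, mem_interior_sub_image]; exact hpP
  have hcomp : IsCompact (convexHull ℝ V) := hV.isCompact_convexHull ℝ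
  have hU := polarDual_eq_convexHull_extremePoints hV h0
  have hUfin := finite_extremePoints_polarDual hV
  have hUr := extremePoints_polarDual_subset_rationalPoints hV hVr
  have hact := fun u (hu : u ∈ (polarDual V).extremePoints ℝ) =>
    exists_active_of_mem_extremePoints hV hu
  have hUV : ∀ u ∈ (polarDual V).extremePoints ℝ, ∀ v ∈ V, inner ℝ u v ≤ 1 := fun u hu v hv =>
    hu.1 v hv
  have hU' : polarDual (convexHull ℝ V) = convexHull ℝ ((polarDual V).extremePoints ℝ) := by
    rw [polarDual_convexHull]; exact hU
  have hmem := mem_iff_of_polarDual_eq (convex_convexHull ℝ V) hcomp.isClosed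
    (interior_subset h0) hU'
  have hint := mem_interior_iff_of_forall_inner_le hUfin hmem
  have hUne : ((polarDual V).extremePoints ℝ).Nonempty := by
    rw [← convexHull_nonempty_iff (𝕜 := ℝ), ← hU]
    exact ⟨0, fun s _ => by simp⟩
  rw [hQeq]
  refine ⟨(polarDual V).extremePoints ℝ, hUfin, ?_, hU'⟩
  generalize (polarDual V).extremePoints ℝ = U at *
  obtain ⟨D, hD, hDc⟩ := exists_common_denominator hUfin hUr
  have hD' : (0 : ℝ) < D := by exact_mod_cast hD
  choose! c hc0 hc1 using hDc
  have hpair : ∀ u ∈ U, ∀ x, (pairing (c u) x : ℝ) = D * inner ℝ u (toPlane x) := fun u hu x =>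
    inner_toPlane_of_scaled (hc0 u hu) (hc1 u hu) x
  classical
  let C : Finset (ℤ × ℤ) := hUfin.toFinset.image c
  have hCmem : ∀ y, y ∈ C ↔ ∃ u ∈ U, c u = y := fun y => by simp [C]
  have hCne : C.Nonempty := by
    obtain ⟨u, hu⟩ := hUne
    exact ⟨c u, (hCmem _).2 ⟨u, hu, rfl⟩⟩
  -- The support function of the polar, scaled by `D`.
  let h : ℤ × ℤ → ℤ := fun x => C.sup' hCne fun y => pairing y x
  have hle : ∀ x, ∀ y ∈ C, pairing y x ≤ h x := fun x y hy =>
    Finset.le_sup' (fun y => pairing y x) hy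
  have hex : ∀ x, ∃ y ∈ C, h x = pairing y x := fun x =>
    C.exists_mem_eq_sup' hCne fun y => pairing y x
  have hleU : ∀ x, ∀ u ∈ U, D * inner ℝ u (toPlane x) ≤ (h x : ℝ) := fun x u hu => by
    rw [← hpair u hu]; exact_mod_cast hle x _ ((hCmem _).2 ⟨u, hu, rfl⟩)
  have hexU : ∀ x, ∃ u ∈ U, (h x : ℝ) = D * inner ℝ u (toPlane x) := fun x => by
    obtain ⟨y, hy, hxy⟩ := hex x
    obtain ⟨u, hu, rfl⟩ := (hCmem y).1 hy
    exact ⟨u, hu, by rw [hxy, hpair u hu]⟩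
  have toPlane_zero : toPlane 0 = 0 := by
    ext i; fin_cases i <;> simp [toPlane]
  have hpos : ∀ x, x ≠ 0 → 0 < h x := by
    intro x hx
    by_contra hneg
    have hneg' : (h x : ℝ) ≤ 0 := by exact_mod_cast not_lt.1 hneg
    refine hx (toPlane_injective ?_)
    rw [toPlane_zero]
    refine eq_zero_of_forall_inner_nonpos hcomp.isBounded hmem fun u hu => ?_
    have := hleU x u hu
    by_contra hc
    have := mul_pos hD' (not_le.1 hc)
    linarith
  have hdvd := dvd_of_polynomial_count C h hle hex hpos hD q (fun n hn => by
    lift n to ℕ using hn.le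
    have hn' : 0 < n := by exact_mod_cast hn
    have := hq n
    rw [latticeCount_eq_ncard hp (hQeq ▸ hmem) hn'] at this
    rw [Int.cast_natCast]
    refine Eq.trans ?_ this.symm
    congr 2
    ext x
    simp only [Set.mem_ofPred_eq]
    constructor
    · intro hx u hu
      have h1 := hleU x u hu
      have h2 : (h x : ℝ) ≤ n * D := by exact_mod_cast hx
      exact le_of_mul_le_mul_left (by linarith) hD'
    · intro hx
      obtain ⟨u, hu, hxu⟩ := hexU x
      have : (h x : ℝ) ≤ n * D := by
        rw [hxu, mul_comm]; exact mul_le_mul_of_nonneg_right (hx u hu) hD'.le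
      exact_mod_cast this) (fun x hx => by
    refine toPlane_injective ?_
    have hx' : (h x : ℝ) < D := by exact_mod_cast hx
    have hin : toPlane x ∈ interior (convexHull ℝ V) := (hint _).2 fun u hu => by
      have := hleU x u hu
      by_contra hc
      have := mul_le_mul_of_nonneg_left (not_lt.1 hc) hD'.le
      linarith
    have hin' : toPlane x + p ∈ interior (convexHull ℝ V₀) := by
      rw [← mem_interior_sub_image p, hQeq]; simpa using hin
    have := huniq _ hin' fun i => by
      obtain ⟨a, ha⟩ := toPlane_mem_latticePoints x i
      obtain ⟨b, hb⟩ := hp i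
      exact ⟨a + b, by rw [PiLp.add_apply, ha, hb]; simp⟩
    rw [toPlane_zero]
    simpa using this)
  intro u hu
  obtain ⟨a, ha, b, hb, hua, hub, hdet⟩ := hact u hu
  obtain ⟨z, hz⟩ := exists_latticePoint_neighbours (hVr ha) (hVr hb) hdet
  have hinteg : ∀ e ∈ ({0, (1, 0), (0, 1)} : Set (ℤ × ℤ)), ∃ m : ℤ,
      inner ℝ u (toPlane (z + e)) = (m : ℝ) := by
    intro e he
    obtain ⟨s, t, hs, ht, hst⟩ := hz e he
    obtain ⟨m, hm⟩ := hdvd (z + e)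
    refine ⟨m, ?_⟩
    have hval : inner ℝ u (toPlane (z + e)) = s + t := by
      rw [hst, inner_add_right, real_inner_smul_right, real_inner_smul_right, hua, hub]; ring
    have hlow := hleU (z + e) u hu
    obtain ⟨u', hu', hup⟩ := hexU (z + e)
    -- `z + e` lies in the cone spanned by `a` and `b`, where `u` is active; every other vertex is
    -- at most `1` on `a` and `b`, so `u` attains the maximum.
    have hupp : inner ℝ u' (toPlane (z + e)) ≤ s + t := by
      rw [hst, inner_add_right, real_inner_smul_right, real_inner_smul_right]
      nlinarith [hUV u' hu' a ha, hUV u' hu' b hb]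
    have hup' := mul_le_mul_of_nonneg_left hupp hD'.le
    rw [hval] at hlow ⊢
    have : (h (z + e) : ℝ) = D * m := by exact_mod_cast hm
    exact mul_left_cancel₀ hD'.ne' (by linarith)
  obtain ⟨m, hm⟩ := hinteg 0 (by simp)
  obtain ⟨m0, hm0⟩ := hinteg (1, 0) (by simp)
  obtain ⟨m1, hm1⟩ := hinteg (0, 1) (by simp)
  rw [inner_eq_coords] at hm hm0 hm1
  simp [toPlane] at hm hm0 hm1
  intro i
  fin_cases i
  · exact ⟨m0 - m, by push_cast; linarith⟩
  · exact ⟨m1 - m, by push_cast; linarith⟩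

end EhrhartPolytope

theorem mainTheorem11 (P : Set (EuclideanSpace ℝ (Fin 2)))
    (hP : EhrhartPolytope.IsQuasiLattice P) (hdim : EhrhartPolytope.affineDim P = 2) :
    EhrhartPolytope.IsDualIntegral P ↔
      ∃! p : EuclideanSpace ℝ (Fin 2), p ∈ interior P ∧ p ∈ EhrhartPolytope.latticePoints 2 := by
  constructor
  · intro h
    have hne : P.Nonempty := by
      rw [Set.nonempty_iff_ne_empty]
      rintro rfl
      rw [EhrhartPolytope.affineDim, vectorSpan_empty, finrank_bot] at hdim
      omega
    exact h.existsUnique_interior (EhrhartPolytope.interior_nonempty_of_affineDim h.1 hne hdim)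
  · rintro ⟨p, ⟨h1, h2⟩, h3⟩
    exact hP.isDualIntegral h1 h2 fun x hx hx' => h3 x ⟨hx, hx'⟩
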